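/- Let $k\ge 0$, let $D_1\in\mathbb{C}^{r_1\times d},\dots,D_{k+1}\in\mathbb{C}^{r_{k+1}\times d}$ with $r_j\le d$ for all $j$, and let $D\in\mathbb{C}^{(r_1+\cdots+r_{k+1})\times d}$ be the matrix obtained by stacking $D_1,\dots,D_{k+1}$. A solution of the row separation problem $\mathsf{P}$ associated with $\{D_1,\dots,D_{k+1}\}$ consists of an integer $g$, a permutation matrix $E$ of dimension $\sum_j r_j$, unitary matrices $H_j$ of dimension $r_j$ $(j=1,\dots,k+1)$, a unitary matrix $L$ of dimension $d$, and rectangular matrices $B_1,\dots,B_g$ such that $$E\,\mathrm{diag}\{H_1,\dots,H_{k+1}\}\,D\,L=\mathrm{diag}\{B_1,\dots,B_g\}.$$ A row separation subspace of $\mathsf{P}$ is a nonzero subspace of $\mathbb{C}^d$ of the form $\mathcal{R}(\overline{L_t}\,B_t^{T})$, for some solution of $\mathsf{P}$ and some $t\in\{1,\dots,g\}$, where $L_t$ consists of the columns of $L$ in the positions of the columns of $B_t$, the bar is entrywise complex conjugation and $\mathcal{R}$ is the column space. A row separation subspace $\mathcal{I}$ is called indivisible if no row separation subspace is properly contained in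 $\mathcal{I}$. A row separation subspace $\mathcal{G}$ is called unambiguous if for every row separation subspace $\mathcal{S}$ one has $\mathcal{G}\subseteq\mathcal{S}$ or $\mathcal{G}\perp\mathcal{S}$ (with respect to the standard Hermitian inner product). Then the following statements are equivalent: 1. $\mathsf{P}$ has only finitely many indivisible subspaces; 2. every indivisible subspace of $\mathsf{P}$ is unambiguous. -/

import Mathlib

open Matrix

/-- A row separation problem over `𝕜`: `k + 1` row blocks `D₁, …, D_{k+1}` with a common
number `d` of columns, the `j`-th block having `r j ≤ d` rows. -/
structure RowSeparationProblem (𝕜 : Type) [RCLike 𝕜] where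
  k : ℕ
  d : ℕ
  r : Fin (k + 1) → ℕ
  r_le : ∀ j, r j ≤ d
  D : ∀ j : Fin (k + 1), Matrix (Fin (r j)) (Fin d) 𝕜

namespace RowSeparationProblem

variable {𝕜 : Type} [RCLike 𝕜] (P : RowSeparationProblem 𝕜)

/-- The rows of the stacked matrix: pairs (block, row of that block). -/
abbrev Row : Type := Σ j : Fin (P.k + 1), Fin (P.r j)

/-- The stacked matrix `D = [D₁ᵀ ⋯ D_{k+1}ᵀ]ᵀ`. -/
def stacked : Matrix P.Row (Fin P.d) 𝕜 := Matrix.of fun i c => P.D i.1 i.2 c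

/-- A solution of the row separation problem: a rearrangement `E` of the rows of the stacked
matrix, unitary matrices `H₁, …, H_{k+1}`, a unitary matrix `L`, and rectangular blocks
`B₁, …, B_g` (with `B_t` of size `p t × q t`) such that
`E · diag{H₁, …, H_{k+1}} · D · L = diag{B₁, …, B_g}`. -/
structure Solution where
  g : ℕ
  p : Fin g → ℕ
  q : Fin g → ℕ
  /-- The permutation matrix `E`, given by the bijection that names, for each row of the block
  diagonal matrix, the row of `diag{H₁, …, H_{k+1}} D L` which is put there. -/
  E : (Σ t : Fin g, Fin (p t)) ≃ P.Row
  H : ∀ j : Fin (P.k + 1), Matrix.unitaryGroup (Fin (P.r j)) 𝕜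
  L : Matrix.unitaryGroup (Fin P.d) 𝕜
  B : ∀ t : Fin g, Matrix (Fin (p t)) (Fin (q t)) 𝕜
  sum_q : ∑ t, q t = P.d
  eq : ((Matrix.blockDiagonal' fun j => (H j : Matrix (Fin (P.r j)) (Fin (P.r j)) 𝕜))
        * P.stacked * (L : Matrix (Fin P.d) (Fin P.d) 𝕜)).submatrix E
          (finSigmaFinEquiv.trans (finCongr sum_q))
      = Matrix.blockDiagonal' B

variable {P}

/-- The place among the `d` columns of column `i` of the `t`-th diagonal block: the columns of
the blocks are listed consecutively, first those of `B₁`, then those of `B₂`, and so on. -/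
def Solution.col (X : P.Solution) (t : Fin X.g) (i : Fin (X.q t)) : Fin P.d :=
  finSigmaFinEquiv.trans (finCongr X.sum_q) ⟨t, i⟩

/-- The columns of `L` which belong to the `t`-th diagonal block. -/
def Solution.Lcols (X : P.Solution) (t : Fin X.g) : Matrix (Fin P.d) (Fin (X.q t)) 𝕜 :=
  (X.L : Matrix (Fin P.d) (Fin P.d) 𝕜).submatrix id (X.col t)

/-- The subspace `𝓡(conj(L_t) B_tᵀ)` of `𝕜ᵈ` cut out by the `t`-th diagonal block, where `L_t`
are the columns of `L` belonging to that block. -/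
noncomputable def Solution.subspace (X : P.Solution) (t : Fin X.g) :
    Submodule 𝕜 (EuclideanSpace 𝕜 (Fin P.d)) :=
  LinearMap.range (Matrix.toEuclideanLin ((X.Lcols t).map star * (X.B t)ᵀ))

variable (P)

/-- Row separation subspaces: the nonzero subspaces cut out by a diagonal block of a solution. -/
def IsRowSeparationSubspace (S : Submodule 𝕜 (EuclideanSpace 𝕜 (Fin P.d))) : Prop :=
  S ≠ ⊥ ∧ ∃ (X : P.Solution) (t : Fin X.g), S = X.subspace t

/-- Indivisible subspaces: row separation subspaces which properly contain no row separation
subspace. -/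
def IsIndivisible (I : Submodule 𝕜 (EuclideanSpace 𝕜 (Fin P.d))) : Prop :=
  P.IsRowSeparationSubspace I ∧ ∀ S, P.IsRowSeparationSubspace S → S = I ∨ ¬ S < I

/-- Unambiguous subspaces: row separation subspaces `G` such that every row separation subspace
contains `G` or is orthogonal to `G`. -/
def IsUnambiguous (G : Submodule 𝕜 (EuclideanSpace 𝕜 (Fin P.d))) : Prop :=
  P.IsRowSeparationSubspace G ∧
    ∀ S, P.IsRowSeparationSubspace S → G ≤ S ∨ Submodule.IsOrtho G S

end RowSeparationProblem

/-! Write `T_j = D_jᵀ` and `A_j = T_j T_j*`. The row separation subspaces are exactly the nonzero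
subspaces of the row space of `D` invariant under every self-adjoint `A_j`
(`isRowSeparationSubspace_iff`), so the indivisible ones are the minimal nonzero invariant
subspaces.

If all of these are unambiguous, distinct ones are orthogonal, and finite dimension leaves room for
finitely many. Conversely, suppose `S` neither contains the indivisible `I` nor is orthogonal to it.
Then `I ⊓ S = ⊥` by minimality, while the projection `Q` onto `S` commutes with all `A_j` and is
nonzero on `I`. The tilted copies `(1 + cQ) I`, one for each scalar `c`, are pairwise distinct and
again indivisible. -/

open scoped InnerProductSpace

namespace RowSeparationProblem

variable {𝕜 : Type} [RCLike 𝕜]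

/-! ### Orthonormal bases and unitary matrices -/

section Orthonormal

/-- An orthonormal basis adapted to a subspace and its orthogonal complement. -/
theorem exists_orthonormalBasis_adapted {E ι : Type*} [NormedAddCommGroup E]
    [InnerProductSpace 𝕜 E] [FiniteDimensional 𝕜 E] [Fintype ι]
    (hι : Module.finrank 𝕜 E = Fintype.card ι) (K : Submodule 𝕜 E) (s : Set ι)
    (hs : Nat.card s = Module.finrank 𝕜 K) :
    ∃ b : OrthonormalBasis ι 𝕜 E, (∀ i ∈ s, b i ∈ K) ∧ ∀ i ∉ s, b i ∈ Kᗮ := by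
  classical
  have hc : Fintype.card s = Module.finrank 𝕜 K := by rw [← hs, Nat.card_eq_fintype_card]
  let c : OrthonormalBasis s 𝕜 K :=
    (stdOrthonormalBasis 𝕜 K).reindex (Fintype.equivFinOfCardEq hc).symm
  let v : ι → E := fun i => if h : i ∈ s then c ⟨i, h⟩ else 0
  have hv : ∀ i : s, v i = c i := fun i => by simp [v]
  have hov : Orthonormal 𝕜 (s.domRestrict v) := by
    have : s.domRestrict v = K.subtypeₗᵢ ∘ c := funext hv
    rw [this]
    exact c.orthonormal.comp_linearIsometry _
  obtain ⟨b, hb⟩ := hov.exists_orthonormalBasis_extension_of_card_eq hι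
  refine ⟨b, fun i hi => ?_, fun i hi => ?_⟩
  · rw [hb i hi, hv ⟨i, hi⟩]
    exact (c ⟨i, hi⟩).2
  · rw [Submodule.mem_orthogonal]
    intro u hu
    have := c.sum_repr ⟨u, hu⟩
    have hu' : u = ∑ j : s, c.repr ⟨u, hu⟩ j • b j := by
      have h := congrArg (Subtype.val) this
      simp only [Submodule.coe_sum, Submodule.coe_smul] at h
      exact h.symm.trans (Finset.sum_congr rfl fun j _ => by rw [hb j j.2, hv j])
    rw [hu', sum_inner]
    refine Finset.sum_eq_zero fun j _ => ?_
    rw [inner_smul_left, b.orthonormal.2 (by rintro rfl; exact hi j.2), mul_zero]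

theorem exists_orthonormalBasis_eq_row {n : ℕ} (U : Matrix.unitaryGroup (Fin n) 𝕜) :
    ∃ b : OrthonormalBasis (Fin n) 𝕜 (EuclideanSpace 𝕜 (Fin n)),
      ∀ i, b i = WithLp.toLp 2 ((U : Matrix (Fin n) (Fin n) 𝕜) i) := by
  have h := Matrix.mem_unitaryGroup_iff.1 U.2
  have ho : Orthonormal 𝕜 (Set.univ.domRestrict fun i =>
      (WithLp.toLp 2 ((U : Matrix (Fin n) (Fin n) 𝕜) i) : EuclideanSpace 𝕜 (Fin n))) := by
    rw [orthonormal_iff_ite]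
    rintro ⟨i, _⟩ ⟨j, _⟩
    have := congrFun (congrFun h j) i
    simp only [Matrix.mul_apply, Matrix.star_apply, Matrix.one_apply] at this
    simpa [PiLp.inner_apply, Set.domRestrict, eq_comm] using this
  obtain ⟨b, hb⟩ := ho.exists_orthonormalBasis_extension_of_card_eq (by simp)
  exact ⟨b, fun i => hb i trivial⟩

theorem of_orthonormalBasis_mem_unitaryGroup {n : ℕ}
    (b : OrthonormalBasis (Fin n) 𝕜 (EuclideanSpace 𝕜 (Fin n))) :
    (Matrix.of fun i k => b i k) ∈ Matrix.unitaryGroup (Fin n) 𝕜 := by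
  rw [Matrix.mem_unitaryGroup_iff]
  ext i j
  have := orthonormal_iff_ite.1 b.orthonormal j i
  simp only [PiLp.inner_apply, RCLike.inner_apply] at this
  simp [Matrix.mul_apply, Matrix.star_apply, Matrix.one_apply, this, eq_comm]

/-- With the rows of `H_j` as basis, this writes `A_j` as a sum of rank-one operators, one for each
row of `H_j D_j`. -/
theorem map_adjoint_eq_sum {E F ι : Type*} [NormedAddCommGroup E] [InnerProductSpace 𝕜 E]
    [FiniteDimensional 𝕜 E] [NormedAddCommGroup F] [InnerProductSpace 𝕜 F]
    [FiniteDimensional 𝕜 F] [Fintype ι] (T : E →ₗ[𝕜] F) (b : OrthonormalBasis ι 𝕜 E) (x : F) :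
    T (LinearMap.adjoint T x) = ∑ i, ⟪T (b i), x⟫_𝕜 • T (b i) := by
  conv_lhs => rw [← b.sum_repr' (LinearMap.adjoint T x)]
  simp [LinearMap.adjoint_inner_right]

theorem range_toEuclideanLin_eq_span {m n : ℕ} (A : Matrix (Fin m) (Fin n) 𝕜) :
    LinearMap.range (Matrix.toEuclideanLin A) =
      Submodule.span 𝕜 (Set.range fun i => (WithLp.toLp 2 (A.col i) : EuclideanSpace 𝕜 (Fin m))) := by
  rw [LinearMap.range_eq_map, ← (EuclideanSpace.basisFun (Fin n) 𝕜).toBasis.span_eq,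
    Submodule.map_span, ← Set.range_comp]
  congr 2
  ext i k
  simp [Matrix.toLpLin_apply]

end Orthonormal

variable (P : RowSeparationProblem 𝕜)

/-- The map `x ↦ D_jᵀ x`, whose range is spanned by the rows of `D_j`. -/
noncomputable def blockMap (j : Fin (P.k + 1)) :
    EuclideanSpace 𝕜 (Fin (P.r j)) →ₗ[𝕜] EuclideanSpace 𝕜 (Fin P.d) :=
  Matrix.toEuclideanLin (P.D j)ᵀ

/-- Subspaces of the row space of the stacked matrix which are invariant under all the
self-adjoint operators `D_jᵀ conj(D_j)`. -/
def IsReducing (S : Submodule 𝕜 (EuclideanSpace 𝕜 (Fin P.d))) : Prop :=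
  S ≤ ⨆ j, LinearMap.range (P.blockMap j) ∧
    ∀ j, ∀ x ∈ S, P.blockMap j (LinearMap.adjoint (P.blockMap j) x) ∈ S

theorem mul_stacked_apply (H : ∀ j, Matrix (Fin (P.r j)) (Fin (P.r j)) 𝕜) (a : P.Row)
    (k : Fin P.d) :
    (Matrix.blockDiagonal' H * P.stacked) a k =
      P.blockMap a.1 (WithLp.toLp 2 (H a.1 a.2)) k := by
  obtain ⟨j, i⟩ := a
  rw [Matrix.mul_apply, Fintype.sum_sigma, Finset.sum_eq_single j]
  · simp [Matrix.blockDiagonal'_apply, stacked, blockMap, Matrix.toLpLin_apply,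
      Matrix.mulVec, dotProduct, mul_comm]
  · intro j' _ hj'
    exact Finset.sum_eq_zero fun i' _ => by
      rw [Matrix.blockDiagonal'_apply_ne _ _ _ hj'.symm, zero_mul]
  · simp

variable {P}

/-! ### Blocks of a solution are invariant -/

namespace Solution

/-- The rows of `diag{H₁, …, H_{k+1}} D`. -/
noncomputable def rowVec (X : P.Solution) (a : P.Row) : EuclideanSpace 𝕜 (Fin P.d) :=
  P.blockMap a.1 (WithLp.toLp 2 ((X.H a.1 : Matrix (Fin (P.r a.1)) (Fin (P.r a.1)) 𝕜) a.2))

/-- Multiplying by `L*` undoes `L`, and a row of block `t` vanishes on the columns of the other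
blocks, so only `L_t` contributes. -/
theorem rowVec_eq (X : P.Solution) (t : Fin X.g) (i : Fin (X.p t)) :
    X.rowVec (X.E ⟨t, i⟩) =
      WithLp.toLp 2 (((X.Lcols t).map star * (X.B t)ᵀ).col i) := by
  have h := X.eq
  set W := (Matrix.blockDiagonal' fun j => (X.H j : Matrix (Fin (P.r j)) (Fin (P.r j)) 𝕜))
        * P.stacked with hW
  set e := finSigmaFinEquiv.trans (finCongr X.sum_q)
  have hL : W = (W * (X.L : Matrix (Fin P.d) (Fin P.d) 𝕜)) *
      star (X.L : Matrix (Fin P.d) (Fin P.d) 𝕜) := by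
    rw [Matrix.mul_assoc, Matrix.mem_unitaryGroup_iff.1 X.L.2, Matrix.mul_one]
  ext k
  have hk : (X.rowVec (X.E ⟨t, i⟩)) k = W (X.E ⟨t, i⟩) k :=
    (P.mul_stacked_apply (fun j => (X.H j : Matrix (Fin (P.r j)) (Fin (P.r j)) 𝕜)) _ _).symm
  rw [hk, hL, Matrix.mul_apply, ← e.sum_comp, Fintype.sum_sigma, Finset.sum_eq_single t]
  · simp only [Matrix.col_apply, Matrix.mul_apply (M := (X.Lcols t).map star)]
    refine Finset.sum_congr rfl fun c _ => ?_
    have := congrFun (congrFun h ⟨t, i⟩) ⟨t, c⟩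
    rw [Matrix.submatrix_apply, Matrix.blockDiagonal'_apply_eq] at this
    rw [this, mul_comm]
    rfl
  · intro s _ hs
    refine Finset.sum_eq_zero fun c _ => ?_
    have := congrFun (congrFun h ⟨t, i⟩) ⟨s, c⟩
    rw [Matrix.submatrix_apply, Matrix.blockDiagonal'_apply_ne _ _ _ hs.symm] at this
    rw [this, zero_mul]
  · simp

theorem subspace_eq_span (X : P.Solution) (t : Fin X.g) :
    X.subspace t = Submodule.span 𝕜 (Set.range fun i => X.rowVec (X.E ⟨t, i⟩)) := by
  simp only [subspace, range_toEuclideanLin_eq_span, rowVec_eq]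

theorem rowVec_orthogonal (X : P.Solution) {a b : Σ t : Fin X.g, Fin (X.p t)} (hab : a.1 ≠ b.1) :
    ⟪X.rowVec (X.E a), X.rowVec (X.E b)⟫_𝕜 = 0 := by
  obtain ⟨s, i⟩ := a
  obtain ⟨t, j⟩ := b
  have hL := Matrix.mem_unitaryGroup_iff'.1 X.L.2
  have hst : (X.Lcols s)ᴴ * X.Lcols t = 0 := by
    ext c c'
    have hne : X.col s c ≠ X.col t c' := fun h =>
      hab (congrArg (fun z : Σ t, Fin (X.q t) => z.1)
        ((finSigmaFinEquiv.trans (finCongr X.sum_q)).injective h))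
    have := congrFun (congrFun hL (X.col s c)) (X.col t c')
    rw [Matrix.one_apply_ne hne, Matrix.mul_apply] at this
    simpa [Matrix.mul_apply, Lcols, Matrix.star_apply] using this
  have key : ((X.Lcols t).map star * (X.B t)ᵀ)ᵀ * (((X.Lcols s).map star * (X.B s)ᵀ).map star) =
      0 := by
    have h1 : ((X.Lcols t).map star)ᵀ * X.Lcols s = 0 := by
      have := congrArg Matrix.conjTranspose hst
      rwa [Matrix.conjTranspose_mul, Matrix.conjTranspose_conjTranspose,
        Matrix.conjTranspose_zero] at this
    have h2 : ((X.Lcols s).map star * (X.B s)ᵀ).map star = X.Lcols s * ((X.B s)ᵀ).map star := by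
      ext; simp [Matrix.mul_apply]
    rw [Matrix.transpose_mul, h2, Matrix.mul_assoc, ← Matrix.mul_assoc _ (X.Lcols s), h1]
    simp
  have := congrFun (congrFun key j) i
  rw [rowVec_eq, rowVec_eq, PiLp.inner_apply]
  rw [Matrix.mul_apply] at this
  simpa using this

theorem isReducing_subspace (X : P.Solution) (t : Fin X.g) : P.IsReducing (X.subspace t) := by
  rw [subspace_eq_span]
  refine ⟨?_, fun j x hx => ?_⟩
  · rw [Submodule.span_le]
    rintro _ ⟨i, rfl⟩
    exact Submodule.mem_iSup_of_mem (X.E ⟨t, i⟩).1 ⟨_, rfl⟩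
  · obtain ⟨b, hb⟩ := exists_orthonormalBasis_eq_row (X.H j)
    rw [map_adjoint_eq_sum _ b]
    refine Submodule.sum_mem _ fun i _ => ?_
    have hw : P.blockMap j (b i) = X.rowVec ⟨j, i⟩ := by rw [hb]; rfl
    rw [hw]
    obtain ⟨⟨s, i'⟩, hs⟩ := X.E.surjective ⟨j, i⟩
    rw [← hs]
    -- In the rank-one expansion of `A_j x`, rows of block `t` stay in its span; rows of other
    -- blocks are orthogonal to `x`.
    by_cases hst : s = t
    · subst hst
      exact Submodule.smul_mem _ _ (Submodule.subset_span ⟨i', rfl⟩)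
    · have h0 : ⟪X.rowVec (X.E ⟨s, i'⟩), x⟫_𝕜 = 0 := by
        have hle : Submodule.span 𝕜 (Set.range fun i => X.rowVec (X.E ⟨t, i⟩)) ≤
            (𝕜 ∙ X.rowVec (X.E ⟨s, i'⟩))ᗮ := by
          rw [Submodule.span_le]
          rintro _ ⟨l, rfl⟩
          exact Submodule.mem_orthogonal_singleton_iff_inner_right.2
            (X.rowVec_orthogonal (a := ⟨s, i'⟩) (b := ⟨t, l⟩) hst)
        exact Submodule.mem_orthogonal_singleton_iff_inner_right.1 (hle hx)
      rw [h0, zero_smul]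
      exact Submodule.zero_mem _

end Solution

/-! ### Invariant subspaces come from solutions -/

/-- Orthonormal bases whose images under the block maps lie either in `S` or in its orthogonal
complement give a solution, one block of which collects the images lying in `S`. -/
theorem Solution.exists_subspace_eq_span {S : Submodule 𝕜 (EuclideanSpace 𝕜 (Fin P.d))}
    (b : ∀ j, OrthonormalBasis (Fin (P.r j)) 𝕜 (EuclideanSpace 𝕜 (Fin (P.r j))))
    (s : Set P.Row) (hbs : ∀ a ∈ s, P.blockMap a.1 (b a.1 a.2) ∈ S)
    (hbs' : ∀ a ∉ s, P.blockMap a.1 (b a.1 a.2) ∈ Sᗮ) :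
    ∃ (X : P.Solution) (t : Fin X.g), X.subspace t =
      Submodule.span 𝕜 ((fun a : P.Row => P.blockMap a.1 (b a.1 a.2)) '' s) := by
  classical
  let grp : P.Row → Fin 2 := fun a => if a ∈ s then 0 else 1
  have hgrp : ∀ a, grp a = 0 ↔ a ∈ s := fun a => by by_cases h : a ∈ s <;> simp [grp, h]
  let w : P.Row → EuclideanSpace 𝕜 (Fin P.d) := fun a => P.blockMap a.1 (b a.1 a.2)
  let q : Fin 2 → ℕ := ![Module.finrank 𝕜 S, P.d - Module.finrank 𝕜 S]
  have hSd : Module.finrank 𝕜 S ≤ P.d := by simpa using Submodule.finrank_le S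
  have hq : ∑ t, q t = P.d := by simp [q, Fin.sum_univ_two, hSd]
  obtain ⟨f, hf0, hf1⟩ := exists_orthonormalBasis_adapted (ι := Σ t, Fin (q t))
    (by simp [hq]) S {z | z.1 = 0}
    ((Nat.card_congr (Equiv.sigmaSubtype (β := fun t => Fin (q t)) (0 : Fin 2))).trans
      (by simp [q]))
  let e : (Σ t, Fin (q t)) ≃ Fin P.d := finSigmaFinEquiv.trans (finCongr hq)
  have hwf : ∀ a z, grp a ≠ z.1 → ⟪f z, w a⟫_𝕜 = 0 := by
    intro a z haz
    by_cases hz : z.1 = 0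
    · exact (Submodule.mem_orthogonal _ _).1
        (hbs' a fun h => haz (by rw [hz, hgrp]; exact h)) _ (hf0 z hz)
    · exact (Submodule.mem_orthogonal' _ _).1 (hf1 z hz) _ (hbs a ((hgrp a).1 (by omega)))
  let E : (Σ t : Fin 2, Fin (Fintype.card {a // grp a = t})) ≃ P.Row :=
    (Equiv.sigmaCongrRight fun t => (Fintype.equivFin {a // grp a = t}).symm).trans
      (Equiv.sigmaFiberEquiv grp)
  have hE : ∀ t i, grp (E ⟨t, i⟩) = t := fun t i =>
    ((Fintype.equivFin {a // grp a = t}).symm i).2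
  let H : ∀ j, Matrix.unitaryGroup (Fin (P.r j)) 𝕜 := fun j =>
    ⟨_, of_orthonormalBasis_mem_unitaryGroup (b j)⟩
  -- The columns of `L` are the conjugates of the vectors `f z`, which makes the entries of
  -- `diag{H_j} D L` inner products with `f z`.
  let L : Matrix.unitaryGroup (Fin P.d) 𝕜 :=
    star ⟨_, of_orthonormalBasis_mem_unitaryGroup (f.reindex e)⟩
  have hWL : ∀ a z, ((Matrix.blockDiagonal' fun j => (H j : Matrix (Fin (P.r j)) (Fin (P.r j)) 𝕜))
      * P.stacked * (L : Matrix (Fin P.d) (Fin P.d) 𝕜)) a (e z) = ⟪f z, w a⟫_𝕜 := by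
    intro a z
    rw [Matrix.mul_apply, PiLp.inner_apply]
    refine Finset.sum_congr rfl fun k _ => ?_
    rw [mul_stacked_apply]
    have hL : (L : Matrix (Fin P.d) (Fin P.d) 𝕜) k (e z) = star (f z k) := by
      simp [L, Matrix.star_apply]
    rw [hL]
    rfl
  let X : P.Solution :=
    { g := 2
      p := fun t => Fintype.card {a // grp a = t}
      q := q
      E := E
      H := H
      L := L
      B := fun t => Matrix.of fun i c => ⟪f ⟨t, c⟩, w (E ⟨t, i⟩)⟫_𝕜
      sum_q := hq
      eq := by
        ext ⟨t, i⟩ ⟨t', c⟩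
        rw [Matrix.submatrix_apply]
        refine (hWL _ _).trans ?_
        by_cases h : t = t'
        · subst h
          rw [Matrix.blockDiagonal'_apply_eq, Matrix.of_apply]
        · rw [Matrix.blockDiagonal'_apply_ne _ _ _ h]
          exact hwf _ _ (by rw [hE]; exact h) }
  refine ⟨X, (0 : Fin 2), ?_⟩
  rw [Solution.subspace_eq_span]
  change Submodule.span 𝕜 (Set.range fun i => w (E ⟨0, i⟩)) = _
  congr 1
  ext v
  constructor
  · rintro ⟨i, rfl⟩
    exact ⟨_, (hgrp _).1 (hE 0 i), rfl⟩
  · rintro ⟨a, ha, rfl⟩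
    obtain ⟨⟨t, i⟩, rfl⟩ := E.surjective a
    have ht : t = 0 := by rw [← hE t i, hgrp]; exact ha
    subst ht
    exact ⟨i, rfl⟩

namespace IsReducing

variable {S S' : Submodule 𝕜 (EuclideanSpace 𝕜 (Fin P.d))}

theorem exists_solution (hS : P.IsReducing S) :
    ∃ (X : P.Solution) (t : Fin X.g), S = X.subspace t := by
  have hb : ∀ j, ∃ (s : Set (Fin (P.r j)))
      (b : OrthonormalBasis (Fin (P.r j)) 𝕜 (EuclideanSpace 𝕜 (Fin (P.r j)))),
      (∀ i ∈ s, P.blockMap j (b i) ∈ S) ∧ ∀ i ∉ s, P.blockMap j (b i) ∈ Sᗮ := by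
    intro j
    -- A basis adapted to `K = T_j* S` works: `T_j K = A_j S ≤ S` by invariance, and `T_j` sends
    -- `Kᗮ` into `Sᗮ` by adjointness.
    set K := S.map (LinearMap.adjoint (P.blockMap j))
    have hKr : Module.finrank 𝕜 K ≤ P.r j := by
      simpa using Submodule.finrank_le K
    have hs : Nat.card {i : Fin (P.r j) | (i : ℕ) < Module.finrank 𝕜 K} = Module.finrank 𝕜 K :=
      (Nat.card_congr (Fin.castLEquiv hKr).symm).trans (Nat.card_fin _)
    obtain ⟨b, h0, h1⟩ := exists_orthonormalBasis_adapted (by simp) K _ hs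
    refine ⟨{i : Fin (P.r j) | (i : ℕ) < Module.finrank 𝕜 K}, b,
      fun i hi => ?_, fun i hi => ?_⟩
    · obtain ⟨x, hx, hxb⟩ := h0 i hi
      rw [← hxb]
      exact hS.2 j x hx
    · rw [Submodule.mem_orthogonal]
      intro u hu
      rw [← LinearMap.adjoint_inner_left]
      exact h1 i hi _ ⟨u, hu, rfl⟩
  choose s b hbs hbs' using hb
  obtain ⟨X, t, hX⟩ := Solution.exists_subspace_eq_span b {a | a.2 ∈ s a.1}
    (fun a ha => hbs _ _ ha) (fun a ha => hbs' _ _ ha)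
  refine ⟨X, t, ?_⟩
  rw [hX]
  set N := Submodule.span 𝕜 ((fun a : P.Row => P.blockMap a.1 (b a.1 a.2)) '' {a | a.2 ∈ s a.1})
    with hN
  have hNS : N ≤ S := by
    rw [hN, Submodule.span_le]
    rintro _ ⟨a, ha, rfl⟩
    exact hbs _ _ ha
  have hall : (⨆ j, LinearMap.range (P.blockMap j)) ≤ N ⊔ Sᗮ := by
    refine iSup_le fun j => ?_
    rintro _ ⟨x, rfl⟩
    rw [← (b j).sum_repr x, map_sum]
    refine Submodule.sum_mem _ fun i _ => ?_
    rw [map_smul]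
    refine Submodule.smul_mem _ _ ?_
    by_cases h : i ∈ s j
    · exact Submodule.mem_sup_left (Submodule.subset_span ⟨⟨j, i⟩, h, rfl⟩)
    · exact Submodule.mem_sup_right (hbs' _ _ h)
  refine le_antisymm ?_ hNS
  -- The modular law applies because `N ≤ S`.
  calc S = (N ⊔ Sᗮ) ⊓ S := (inf_eq_right.2 (hS.1.trans hall)).symm
    _ = N ⊔ Sᗮ ⊓ S := sup_inf_assoc_of_le _ hNS
    _ ≤ N := by rw [inf_comm, Submodule.inf_orthogonal_eq_bot, sup_bot_eq]

/-! ### Operations preserving invariance -/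

theorem inf (hS : P.IsReducing S) (hS' : P.IsReducing S') : P.IsReducing (S ⊓ S') :=
  ⟨inf_le_left.trans hS.1, fun j x hx => ⟨hS.2 j x hx.1, hS'.2 j x hx.2⟩⟩

theorem map (hS : P.IsReducing S)
    {φ : EuclideanSpace 𝕜 (Fin P.d) →ₗ[𝕜] EuclideanSpace 𝕜 (Fin P.d)}
    (hφ : ∀ x ∈ S, φ x ∈ ⨆ j, LinearMap.range (P.blockMap j))
    (hcomm : ∀ j x, P.blockMap j (LinearMap.adjoint (P.blockMap j) (φ x)) =
      φ (P.blockMap j (LinearMap.adjoint (P.blockMap j) x))) :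
    P.IsReducing (S.map φ) := by
  refine ⟨?_, ?_⟩
  · rintro _ ⟨x, hx, rfl⟩
    exact hφ x hx
  · rintro j _ ⟨x, hx, rfl⟩
    exact ⟨_, hS.2 j x hx, (hcomm j x).symm⟩

theorem inf_comap (hS : P.IsReducing S) (hS' : P.IsReducing S')
    {φ : EuclideanSpace 𝕜 (Fin P.d) →ₗ[𝕜] EuclideanSpace 𝕜 (Fin P.d)}
    (hcomm : ∀ j x, P.blockMap j (LinearMap.adjoint (P.blockMap j) (φ x)) =
      φ (P.blockMap j (LinearMap.adjoint (P.blockMap j) x))) :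
    P.IsReducing (S ⊓ S'.comap φ) := by
  refine ⟨inf_le_left.trans hS.1, fun j x hx => ⟨hS.2 j x hx.1, ?_⟩⟩
  rw [SetLike.mem_coe, Submodule.mem_comap, ← hcomm]
  exact hS'.2 j _ hx.2

/-- A self-adjoint operator preserving `S` also preserves `Sᗮ`. -/
theorem starProjection_comm (hS : P.IsReducing S) (j : Fin (P.k + 1))
    (x : EuclideanSpace 𝕜 (Fin P.d)) :
    P.blockMap j (LinearMap.adjoint (P.blockMap j) (S.starProjection x)) =
      S.starProjection (P.blockMap j (LinearMap.adjoint (P.blockMap j) x)) := by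
  refine (Submodule.eq_starProjection_of_mem_orthogonal
    (hS.2 j _ (Submodule.starProjection_apply_mem _ _)) ?_).symm
  rw [← map_sub, ← map_sub, Submodule.mem_orthogonal]
  intro u hu
  rw [← LinearMap.adjoint_inner_left, LinearMap.adjoint_inner_right]
  exact Submodule.sub_starProjection_mem_orthogonal x _ (hS.2 j u hu)

end IsReducing

/-! ### Finiteness and unambiguity -/

theorem isRowSeparationSubspace_iff {S : Submodule 𝕜 (EuclideanSpace 𝕜 (Fin P.d))} :
    P.IsRowSeparationSubspace S ↔ S ≠ ⊥ ∧ P.IsReducing S :=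
  and_congr_right fun _ =>
    ⟨by rintro ⟨X, t, rfl⟩; exact X.isReducing_subspace t, IsReducing.exists_solution⟩

theorem isIndivisible_iff {I : Submodule 𝕜 (EuclideanSpace 𝕜 (Fin P.d))} :
    P.IsIndivisible I ↔
      (I ≠ ⊥ ∧ P.IsReducing I) ∧ ∀ S, P.IsReducing S → S ≤ I → S = ⊥ ∨ S = I := by
  simp only [IsIndivisible, isRowSeparationSubspace_iff]
  refine and_congr_right fun _ => ⟨fun h S hS hSI => ?_, fun h S hS => ?_⟩
  · by_cases h0 : S = ⊥
    · exact Or.inl h0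
    · rcases h S ⟨h0, hS⟩ with h | h
      · exact Or.inr h
      · exact Or.inr (hSI.eq_or_lt.resolve_right h)
  · by_cases hlt : S < I
    · exact Or.inl ((h S hS.2 hlt.le).resolve_left hS.1)
    · exact Or.inr hlt

theorem finite_isIndivisible (h : ∀ I, P.IsIndivisible I → P.IsUnambiguous I) :
    {I | P.IsIndivisible I}.Finite := by
  have hind : iSupIndep
      (fun I : {I | P.IsIndivisible I} => (I : Submodule 𝕜 (EuclideanSpace 𝕜 (Fin P.d)))) := by
    refine OrthogonalFamily.independent (OrthogonalFamily.of_pairwise ?_)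
    rintro ⟨I, hI⟩ ⟨J, hJ⟩ hne
    refine ((h I hI).2 J hJ.1).resolve_left fun hle => hne (Subtype.ext ?_)
    exact (hJ.2 I hI.1).resolve_right fun hn => hn (lt_of_le_of_ne hle fun h => hne (Subtype.ext h))
  have := WellFoundedGT.finite_of_iSupIndep hind fun I => I.2.1.1
  exact Set.toFinite _

theorem infinite_isIndivisible {I S : Submodule 𝕜 (EuclideanSpace 𝕜 (Fin P.d))}
    (hI : P.IsIndivisible I) (hS : P.IsReducing S) (hle : ¬ I ≤ S) (hort : ¬ I ⟂ S) :
    {I | P.IsIndivisible I}.Infinite := by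
  obtain ⟨⟨hI0, hIr⟩, hmin⟩ := isIndivisible_iff.1 hI
  have hdisj : ∀ x ∈ I, x ∈ S → x = 0 := by
    have h0 : I ⊓ S = ⊥ := (hmin _ (hIr.inf hS) inf_le_left).resolve_right fun h =>
      hle (inf_eq_left.1 h)
    exact fun x hxI hxS => (Submodule.mem_bot 𝕜).1 (h0 ▸ ⟨hxI, hxS⟩)
  let Q : EuclideanSpace 𝕜 (Fin P.d) →ₗ[𝕜] EuclideanSpace 𝕜 (Fin P.d) := S.starProjection
  have hQS : ∀ x, Q x ∈ S := fun x => Submodule.starProjection_apply_mem _ _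
  let φ : 𝕜 → EuclideanSpace 𝕜 (Fin P.d) →ₗ[𝕜] EuclideanSpace 𝕜 (Fin P.d) := fun c =>
    LinearMap.id + c • Q
  have hφ : ∀ c x, φ c x = x + c • Q x := fun c x => rfl
  have hcomm : ∀ c j x, P.blockMap j (LinearMap.adjoint (P.blockMap j) (φ c x)) =
      φ c (P.blockMap j (LinearMap.adjoint (P.blockMap j) x)) := by
    intro c j x
    simp only [hφ, map_add, map_smul]
    rw [show P.blockMap j (LinearMap.adjoint (P.blockMap j) (Q x)) = Q _ from
      hS.starProjection_comm j x]
  -- Allowing `c ≠ c'` serves both injectivity on `I` and distinctness of the images: `x - y` lies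
  -- in `I ⊓ S`.
  have hinj : ∀ c c', ∀ x ∈ I, ∀ y ∈ I, φ c x = φ c' y → x = y := by
    intro c c' x hx y hy hxy
    rw [hφ, hφ] at hxy
    refine sub_eq_zero.1 (hdisj _ (I.sub_mem hx hy) ?_)
    rw [show x - y = c' • Q y - c • Q x by
      rw [sub_eq_sub_iff_add_eq_add, hxy, add_comm]]
    exact S.sub_mem (S.smul_mem _ (hQS _)) (S.smul_mem _ (hQS _))
  obtain ⟨x₀, hx₀, hQx₀⟩ : ∃ x ∈ I, Q x ≠ 0 := by
    by_contra! hall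
    exact hort fun x hx => (Submodule.starProjection_apply_eq_zero_iff S).1 (hall x hx)
  refine Set.infinite_of_injective_forall_mem (f := fun c => I.map (φ c)) ?_ ?_
  · intro c c' hcc
    obtain ⟨y, hy, hyx⟩ : φ c x₀ ∈ I.map (φ c') :=
      hcc.le (Submodule.mem_map_of_mem hx₀)
    obtain rfl := hinj _ _ _ hy _ hx₀ hyx
    rw [hφ, hφ, add_right_inj] at hyx
    exact (smul_left_injective 𝕜 hQx₀ hyx).symm
  · intro c
    refine isIndivisible_iff.2 ⟨⟨fun h => hI0 ?_, ?_⟩, fun S' hS' hle' => ?_⟩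
    · rw [Submodule.eq_bot_iff]
      intro x hx
      have : φ c x = 0 := (Submodule.mem_bot 𝕜).1 (h ▸ Submodule.mem_map_of_mem hx)
      exact hinj c c x hx 0 I.zero_mem (by rw [this, map_zero])
    · refine hIr.map (fun x hx => ?_) (hcomm c)
      exact Submodule.add_mem _ (hIr.1 hx) (Submodule.smul_mem _ _ (hS.1 (hQS x)))
    -- Minimality transfers by pulling `S'` back to an invariant subspace of `I`.
    · have hmap : (I ⊓ S'.comap (φ c)).map (φ c) = S' := by
        refine le_antisymm ?_ fun y hy => ?_
        · rintro _ ⟨x, hx, rfl⟩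
          exact hx.2
        · obtain ⟨x, hx, rfl⟩ := hle' hy
          exact ⟨x, ⟨hx, hy⟩, rfl⟩
      rcases hmin _ (hIr.inf_comap hS' (hcomm c)) inf_le_left with h | h
      · exact Or.inl (by rw [← hmap, h, Submodule.map_bot])
      · exact Or.inr (by rw [← hmap, h])

end RowSeparationProblem

theorem mainTheorem7 (P : RowSeparationProblem ℂ) :
    {I : Submodule ℂ (EuclideanSpace ℂ (Fin P.d)) | P.IsIndivisible I}.Finite ↔
      ∀ I : Submodule ℂ (EuclideanSpace ℂ (Fin P.d)), P.IsIndivisible I → P.IsUnambiguous I := by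
  refine ⟨fun hfin I hI => ⟨hI.1, fun S hS => ?_⟩, RowSeparationProblem.finite_isIndivisible⟩
  by_contra! h
  exact RowSeparationProblem.infinite_isIndivisible hI
    (RowSeparationProblem.isRowSeparationSubspace_iff.1 hS).2 h.1 h.2 hfin
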